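/- Let $\sigma>0$ and $\varepsilon>0$ be fixed. For $d\ge 1$ and $\theta_0\in\mathbb{R}^d$, let the data be distributed as $x\sim\mathcal N(0,I_d)$, $y=\theta_0^\top x+z$, where $z\sim\mathcal N(0,\sigma^2)$ is independent of $x$. For $\theta\in\mathbb{R}^d$ let $\mathrm{SR}(\theta)=\mathbb E_{(x,y)}\big[(\theta^\top x-y)^2\big]$ be the nominal risk of $f_\theta(x)=\theta^\top x$, and for $\rho\in[0,1)$ let $$\mathrm{PR}(\theta;\rho)=\mathbb E_{(x,y)}\Big[\inf\big\{u\in\mathbb R:\ \mathbb P_{\delta}\big((\theta^\top(x+\delta)-y)^2>u\big)\le\rho\big\}\Big]$$ be its probabilistically robust risk, i.e. the expectation of the $\rho$-essential supremum over $\delta$ of the squared loss, where $\delta$ is uniform on the ball $\{\|\delta\|_2\le\varepsilon\}\subset\mathbb R^d$. By convention $\mathrm{PR}(\theta;1)=\mathbb E_{(x,y)}\mathbb E_\delta\big[(\theta^\top(x+\delta)-y)^2\big]$. All these expectations are finite, and $\min_\theta\mathrm{SR}(\theta)=\mathrm{SR}(\theta_0)=\sigma^2$. Let $\Theta\subset\mathbb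 R^d$ contain $\theta_0$, and let $\theta^\star\in\Theta$ be any minimizer of $\mathrm{PR}(\cdot\,;\rho)$ over $\Theta$. (a) For every $\rho\in(0,1]$ and every $R$ there is a constant $C=C(\rho,\varepsilon,\sigma,R)$ such that, for all $d$, all $\theta_0$ with $\|\theta_0\|_2\le R$, all such $\Theta$ and all such $\theta^\star$, $$\big|\mathrm{PR}(\theta^\star;\rho)-\mathrm{SR}(\theta_0)\big|\le \frac{C}{\sqrt d}.$$ (b) If $\rho=0$, the gap is bounded and does not vanish: for every $R$ there is a constant $C=C(\varepsilon,\sigma,R)$ with $|\mathrm{PR}(\theta^\star;0)-\mathrm{SR}(\theta_0)|\le C$ for all $d$, all $\theta_0$ with $\|\theta_0\|_2\le R$, all $\Theta$ and all $\theta^\star$; and for every $r>0$ there is a constant $c=c(\varepsilon,\sigma,r)>0$ with $\mathrm{PR}(\theta^\star;0)-\mathrm{SR}(\theta_0)\ge c$ for all $d$, all $\theta_0$ with $\|\theta_0\|_2\ge r$, all $\Theta$ and all $\theta^\star$. -/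

import Mathlib

open MeasureTheory ProbabilityTheory

noncomputable section

/-- The space `ℝ^d` with the Euclidean norm. -/
abbrev Euc (d : ℕ) : Type := EuclideanSpace ℝ (Fin d)

/-- The `ρ`-essential supremum of `f` under `μ`, for a tolerance level `0 ≤ ρ < 1`:
the infimum of the set of real `u` such that `f` exceeds `u` with probability at most `ρ`. -/
def rhoEssSup {Ω : Type*} [MeasurableSpace Ω] (μ : Measure Ω) (ρ : ℝ) (f : Ω → ℝ) : ℝ :=
  sInf {u : ℝ | μ (f ⁻¹' Set.Ioi u) ≤ ENNReal.ofReal ρ}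

/-- The squared loss. -/
def sqLoss (prediction y : ℝ) : ℝ := (prediction - y) ^ 2

/-- The linear hypothesis `x ↦ θᵀ x`. -/
def linHyp {d : ℕ} (θ : Euc d) (x : Euc d) : ℝ := inner ℝ θ x

/-- The law of `(x, y)`, where `y = θ₀ᵀ x + z` with independent `x ~ N(0, I_d)` and
`z ~ N(0, σ²)`. -/
def linRegLaw {d : ℕ} (θ₀ : Euc d) (σ : ℝ) : Measure (Euc d × ℝ) :=
  ((stdGaussian (Euc d)).prod (gaussianReal 0 (σ ^ 2).toNNReal)).map
    (fun p => (p.1, inner ℝ θ₀ p.1 + p.2))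

/-- The uniform distribution on the closed Euclidean ball of radius `ε` about the origin. -/
def ballUniform (d : ℕ) (ε : ℝ) : Measure (Euc d) :=
  cond volume (Metric.closedBall (0 : Euc d) ε)

/-- The nominal (clean) risk of a hypothesis `h`. -/
def nominalRisk {d : ℕ} (D : Measure (Euc d × ℝ)) (h : Euc d → ℝ) : ℝ :=
  ∫ p, sqLoss (h p.1) p.2 ∂D

/-- The probabilistically robust loss of `h` at the data point `p = (x, y)`: the `ρ`-essential
supremum over `δ ~ r` of the loss at `(x + δ, y)` if `ρ ≠ 1`; at the end point `ρ = 1` the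
problem is by convention that of minimizing the average loss under `δ ~ r`. -/
def probRobustLoss {d : ℕ} (r : Measure (Euc d)) (ρ : ℝ) (h : Euc d → ℝ) (p : Euc d × ℝ) : ℝ :=
  open Classical in
  if ρ = 1 then ∫ δ, sqLoss (h (p.1 + δ)) p.2 ∂r
  else rhoEssSup r ρ (fun δ => sqLoss (h (p.1 + δ)) p.2)

/-- The probabilistically robust risk of `h` at tolerance level `ρ`. -/
def probRobustRisk {d : ℕ} (D : Measure (Euc d × ℝ)) (r : Measure (Euc d)) (ρ : ℝ)
    (h : Euc d → ℝ) : ℝ :=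
  ∫ p, probRobustLoss r ρ h p ∂D

/-- `θ` is an optimal solution, over the parameter set `Θ`, of the probabilistically robust
linear regression problem with tolerance `ρ`. -/
def IsProbRobustOptimal {d : ℕ} (θ₀ : Euc d) (σ ε ρ : ℝ) (Θ : Set (Euc d)) (θ : Euc d) : Prop :=
  θ ∈ Θ ∧ IsMinOn
    (fun θ' => probRobustRisk (linRegLaw θ₀ σ) (ballUniform d ε) ρ (linHyp θ')) Θ θ

end

/-!
The loss of `x ↦ θᵀ x` at a perturbed data point is `(g + T δ) ^ 2`, where `g = θᵀ x - y` is the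
residual and `T δ = θᵀ δ`. Since the uniform law on the ball is invariant under rotations, `T` has
second moment at most `ε² ‖θ‖² / d`. For `ρ > 0` the tolerance absorbs, by Chebyshev's inequality,
all `δ` at which `|T δ|` exceeds a multiple of `‖θ‖ / √d`, so the robust risk differs from the
nominal risk `‖θ - θ₀‖² + σ²` by a term of order `1 / √d`. For `ρ = 0` the worst case over the whole
ball counts: the loss becomes `(|g| + ε ‖θ‖) ^ 2`, whose mean exceeds the nominal risk by at least
`ε² ‖θ‖²`, and `‖θ - θ₀‖² + ε² ‖θ‖²` is bounded below by a positive multiple of `‖θ₀‖²`.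
-/

section RhoEssSup

variable {Ω : Type*} [MeasurableSpace Ω] {μ : Measure Ω} {ρ B c u : ℝ} {f f' : Ω → ℝ}

theorem measure_preimage_Ioi_eq_zero (hB : ∀ᵐ ω ∂μ, f ω ≤ B) : μ (f ⁻¹' Set.Ioi B) = 0 := by
  simp only [ae_iff, not_le] at hB
  exact hB

theorem nonempty_setOf_measure_preimage_Ioi_le (hB : ∀ᵐ ω ∂μ, f ω ≤ B) :
    {u : ℝ | μ (f ⁻¹' Set.Ioi u) ≤ ENNReal.ofReal ρ}.Nonempty :=
  ⟨B, by simp [measure_preimage_Ioi_eq_zero hB]⟩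

theorem le_rhoEssSup_zero_of_mem_support [TopologicalSpace Ω] (hf : Continuous f)
    (hB : ∀ᵐ ω ∂μ, f ω ≤ B) {ω : Ω} (hω : ω ∈ μ.support) : f ω ≤ rhoEssSup μ 0 f := by
  refine le_csInf (nonempty_setOf_measure_preimage_Ioi_le hB) fun u hu => ?_
  by_contra! hlt
  have hpos := (Measure.mem_support_iff_forall ω).1 hω _
    ((isOpen_Ioi.preimage hf).mem_nhds (Set.mem_preimage.2 hlt))
  simp only [ENNReal.ofReal_zero, nonpos_iff_eq_zero, Set.mem_ofPred_eq] at hu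
  exact hpos.ne' hu

theorem measure_setOf_lt_add_ofReal_lt_one (hc : ∀ᵐ ω ∂μ, c ≤ f ω) (hρ : ρ < 1) :
    μ {ω | f ω < c} + ENNReal.ofReal ρ < 1 := by
  have hnull : μ {ω | f ω < c} = 0 := by simpa only [ae_iff, not_le] using hc
  rwa [hnull, zero_add, ENNReal.ofReal_lt_one]

variable [IsProbabilityMeasure μ]

theorem le_of_measure_preimage_Ioi_le (hc : μ {ω | f ω < c} + ENNReal.ofReal ρ < 1)
    (hu : μ (f ⁻¹' Set.Ioi u) ≤ ENNReal.ofReal ρ) : c ≤ u := by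
  by_contra! huc
  have hcover : (Set.univ : Set Ω) ⊆ {ω | f ω < c} ∪ f ⁻¹' Set.Ioi u := fun ω _ =>
    (le_or_gt (f ω) u).imp (·.trans_lt huc) id
  have hone : 1 ≤ μ {ω | f ω < c} + ENNReal.ofReal ρ :=
    calc (1 : ENNReal) = μ Set.univ := measure_univ.symm
      _ ≤ μ {ω | f ω < c} + μ (f ⁻¹' Set.Ioi u) :=
        (measure_mono hcover).trans (measure_union_le _ _)
      _ ≤ μ {ω | f ω < c} + ENNReal.ofReal ρ := by gcongr
  exact hone.not_gt hc

theorem le_rhoEssSup (hB : ∀ᵐ ω ∂μ, f ω ≤ B) (hc : μ {ω | f ω < c} + ENNReal.ofReal ρ < 1) :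
    c ≤ rhoEssSup μ ρ f :=
  le_csInf (nonempty_setOf_measure_preimage_Ioi_le hB)
    fun _ hu => le_of_measure_preimage_Ioi_le hc hu

theorem rhoEssSup_le (hc : ∀ᵐ ω ∂μ, c ≤ f ω) (hρ : ρ < 1)
    (hu : μ (f ⁻¹' Set.Ioi u) ≤ ENNReal.ofReal ρ) : rhoEssSup μ ρ f ≤ u :=
  csInf_le ⟨c, fun _ hv =>
    le_of_measure_preimage_Ioi_le (measure_setOf_lt_add_ofReal_lt_one hc hρ) hv⟩ hu

theorem rhoEssSup_le_add {k : ℝ} (hc : ∀ᵐ ω ∂μ, c ≤ f ω) (hB : ∀ᵐ ω ∂μ, f' ω ≤ B) (hρ : ρ < 1)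
    (h : ∀ᵐ ω ∂μ, f ω ≤ f' ω + k) : rhoEssSup μ ρ f ≤ rhoEssSup μ ρ f' + k := by
  rw [← sub_le_iff_le_add]
  refine le_csInf (nonempty_setOf_measure_preimage_Ioi_le hB) fun u hu => ?_
  rw [sub_le_iff_le_add]
  refine rhoEssSup_le hc hρ ((measure_mono_ae ?_).trans hu)
  filter_upwards [h] with ω hω (hlt : u + k < f ω)
  exact lt_of_add_lt_add_right (hlt.trans_le hω)

end RhoEssSup

section TolerantSup

variable {Ω : Type*} [MeasurableSpace Ω]

/-- The robust value of a random loss `f` at tolerance `ρ`: its `ρ`-essential supremum if `ρ ≠ 1`,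
and its mean at the end point `ρ = 1`. With `f δ` the loss at the input perturbed by `δ`, this is
`probRobustLoss`. -/
noncomputable def tolerantSup (μ : Measure Ω) (ρ : ℝ) (f : Ω → ℝ) : ℝ :=
  open Classical in if ρ = 1 then ∫ ω, f ω ∂μ else rhoEssSup μ ρ f

theorem tolerantSup_one (μ : Measure Ω) (f : Ω → ℝ) : tolerantSup μ 1 f = ∫ ω, f ω ∂μ :=
  if_pos rfl

theorem tolerantSup_of_ne_one (μ : Measure Ω) {ρ : ℝ} (hρ : ρ ≠ 1) (f : Ω → ℝ) :
    tolerantSup μ ρ f = rhoEssSup μ ρ f :=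
  if_neg hρ

variable {μ : Measure Ω} [IsProbabilityMeasure μ] {ρ B k b : ℝ} {f f' T : Ω → ℝ}

theorem tolerantSup_nonneg (hf : ∀ᵐ ω ∂μ, 0 ≤ f ω) (hB : ∀ᵐ ω ∂μ, f ω ≤ B) (hρ : ρ ≤ 1) :
    0 ≤ tolerantSup μ ρ f := by
  rcases hρ.eq_or_lt with rfl | hlt
  · rw [tolerantSup_one]
    exact integral_nonneg_of_ae hf
  · rw [tolerantSup_of_ne_one μ hlt.ne]
    exact le_rhoEssSup hB (measure_setOf_lt_add_ofReal_lt_one hf hlt)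

theorem tolerantSup_le (hf : ∀ᵐ ω ∂μ, 0 ≤ f ω) (hB : ∀ᵐ ω ∂μ, f ω ≤ B) (hρ : ρ ≤ 1) :
    tolerantSup μ ρ f ≤ B := by
  rcases hρ.eq_or_lt with rfl | hlt
  · rw [tolerantSup_one]
    simpa using integral_mono_of_nonneg hf (integrable_const B) hB
  · rw [tolerantSup_of_ne_one μ hlt.ne]
    exact rhoEssSup_le hf hlt (by simp [measure_preimage_Ioi_eq_zero hB])

theorem tolerantSup_le_add (hf : ∀ᵐ ω ∂μ, 0 ≤ f ω) (hf' : Integrable f' μ)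
    (hB : ∀ᵐ ω ∂μ, f' ω ≤ B) (hρ : ρ ≤ 1) (h : ∀ᵐ ω ∂μ, f ω ≤ f' ω + k) :
    tolerantSup μ ρ f ≤ tolerantSup μ ρ f' + k := by
  rcases hρ.eq_or_lt with rfl | hlt
  · rw [tolerantSup_one, tolerantSup_one]
    calc ∫ ω, f ω ∂μ ≤ ∫ ω, (f' ω + k) ∂μ :=
          integral_mono_of_nonneg hf (hf'.add (integrable_const k)) h
      _ = ∫ ω, f' ω ∂μ + k := by
          rw [integral_add hf' (integrable_const k), integral_const, probReal_univ, one_smul]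
  · rw [tolerantSup_of_ne_one μ hlt.ne, tolerantSup_of_ne_one μ hlt.ne]
    exact rhoEssSup_le_add hf hB hlt h

theorem sq_add_le_sq_add_sq {s : ℝ} (g : ℝ) (hs : |s| ≤ b) : (g + s) ^ 2 ≤ (|g| + b) ^ 2 := by
  rw [← sq_abs (g + s)]
  gcongr
  exact (abs_add_le g s).trans (by gcongr)

theorem sq_add_le_sq_add_add {s : ℝ} (g a : ℝ) (hs : |s| ≤ b) :
    (g + s) ^ 2 ≤ (a + s) ^ 2 + |g - a| * (|g| + |a| + 2 * b) := by
  have hsum : |g + a + 2 * s| ≤ |g| + |a| + 2 * b :=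
    calc |g + a + 2 * s| ≤ |g| + |a| + |2 * s| := abs_add_three _ _ _
      _ ≤ |g| + |a| + 2 * b := by rw [abs_mul, abs_two]; gcongr
  calc (g + s) ^ 2 = (a + s) ^ 2 + (g - a) * (g + a + 2 * s) := by ring
    _ ≤ (a + s) ^ 2 + |g - a| * |g + a + 2 * s| := by
        rw [← abs_mul]; gcongr; exact le_abs_self _
    _ ≤ (a + s) ^ 2 + |g - a| * (|g| + |a| + 2 * b) := by gcongr

theorem continuous_tolerantSup_sq (hT : AEStronglyMeasurable T μ) (hb : ∀ᵐ ω ∂μ, |T ω| ≤ b)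
    (hρ : ρ ≤ 1) : Continuous fun g : ℝ => tolerantSup μ ρ fun ω => (g + T ω) ^ 2 := by
  set φ : ℝ → ℝ := fun g => tolerantSup μ ρ fun ω => (g + T ω) ^ 2
  have hφ (g a : ℝ) : φ g ≤ φ a + |g - a| * (|g| + |a| + 2 * b) :=
    tolerantSup_le_add (.of_forall fun _ => sq_nonneg _)
      ((memLp_const a).add (.of_bound hT b hb)).integrable_sq
      (hb.mono fun _ h => sq_add_le_sq_add_sq a h) hρ
      (hb.mono fun _ h => sq_add_le_sq_add_add g a h)
  refine continuous_iff_continuousAt.2 fun a => tendsto_iff_dist_tendsto_zero.2 ?_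
  have hmod : Continuous fun g : ℝ => |g - a| * (|g| + |a| + 2 * b) := by fun_prop
  refine squeeze_zero (fun _ => dist_nonneg) (fun g => ?_) (by simpa using hmod.tendsto a)
  have hag := hφ a g
  rw [abs_sub_comm a g, add_comm |a| |g|] at hag
  rw [Real.dist_eq, abs_sub_le_iff]
  exact ⟨sub_le_iff_le_add'.2 (hφ g a), sub_le_iff_le_add'.2 hag⟩

theorem measure_setOf_lt_abs_le {p t : ℝ} (hT : MemLp T 2 μ) (ht : 0 ≤ t)
    (hvar : ∫ ω, T ω ^ 2 ∂μ ≤ p * t ^ 2) : μ {ω | t < |T ω|} ≤ ENNReal.ofReal p := by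
  have hnonneg : 0 ≤ᵐ[μ] fun ω => T ω ^ 2 := .of_forall fun _ => sq_nonneg _
  rcases ht.eq_or_lt with rfl | hpos
  · have hzero : ∫ ω, T ω ^ 2 ∂μ = 0 :=
      le_antisymm (by simpa using hvar) (integral_nonneg_of_ae hnonneg)
    have hT0 : ∀ᵐ ω ∂μ, |T ω| ≤ 0 := by
      filter_upwards [(integral_eq_zero_iff_of_nonneg_ae hnonneg hT.integrable_sq).1 hzero]
        with ω hω
      simpa using hω
    exact (measure_preimage_Ioi_eq_zero hT0).le.trans zero_le
  · have hsub : {ω | t < |T ω|} ⊆ {ω | t ^ 2 ≤ T ω ^ 2} := fun ω (hω : t < |T ω|) =>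
      sq_le_sq.2 ((abs_of_pos hpos).trans_le hω.le)
    have hmarkov : t ^ 2 * μ.real {ω | t ^ 2 ≤ T ω ^ 2} ≤ t ^ 2 * p :=
      (mul_meas_ge_le_integral_of_nonneg hnonneg hT.integrable_sq (t ^ 2)).trans
        (hvar.trans_eq (mul_comm _ _))
    rw [← ofReal_measureReal]
    exact ENNReal.ofReal_le_ofReal
      ((measureReal_mono hsub).trans (le_of_mul_le_mul_left hmarkov (pow_pos hpos 2)))

theorem abs_integral_le_of_integral_sq_le {t : ℝ} (hT : MemLp T 2 μ) (ht : 0 ≤ t)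
    (hvar : ∫ ω, T ω ^ 2 ∂μ ≤ t ^ 2) : |∫ ω, T ω ∂μ| ≤ t := by
  have hsq : 0 ≤ ∫ ω, T ω ^ 2 ∂μ - (∫ ω, T ω ∂μ) ^ 2 :=
    (variance_nonneg T μ).trans_eq (variance_eq_sub hT)
  exact abs_le_of_sq_le_sq ((sub_nonneg.1 hsq).trans hvar) ht

theorem abs_integral_sq_add_sub_sq_le {t : ℝ} (hT : MemLp T 2 μ) (ht : 0 ≤ t)
    (hvar : ∫ ω, T ω ^ 2 ∂μ ≤ t ^ 2) (g : ℝ) :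
    |∫ ω, (g + T ω) ^ 2 ∂μ - g ^ 2| ≤ 2 * |g| * t + t ^ 2 := by
  have hlin : Integrable (fun ω => 2 * g * T ω) μ := (hT.integrable one_le_two).const_mul _
  have haff : Integrable (fun ω => g ^ 2 + 2 * g * T ω) μ := (integrable_const _).add hlin
  have hexpand : ∫ ω, (g + T ω) ^ 2 ∂μ - g ^ 2 = 2 * g * ∫ ω, T ω ∂μ + ∫ ω, T ω ^ 2 ∂μ := by
    simp only [add_sq]
    rw [integral_add haff hT.integrable_sq,
      integral_add (integrable_const _) hlin, integral_const_mul, integral_const, probReal_univ,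
      one_smul]
    ring
  have hsq : 0 ≤ ∫ ω, T ω ^ 2 ∂μ := integral_nonneg fun ω => sq_nonneg (T ω)
  calc |∫ ω, (g + T ω) ^ 2 ∂μ - g ^ 2|
      ≤ |2 * g * ∫ ω, T ω ∂μ| + |∫ ω, T ω ^ 2 ∂μ| := hexpand ▸ abs_add_le _ _
    _ = 2 * |g| * |∫ ω, T ω ∂μ| + ∫ ω, T ω ^ 2 ∂μ := by
        rw [abs_mul, abs_mul, abs_two, abs_of_nonneg hsq]
    _ ≤ 2 * |g| * t + t ^ 2 := by
        gcongr
        exact abs_integral_le_of_integral_sq_le hT ht hvar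

theorem rhoEssSup_sq_add_le {t : ℝ} (hT : MemLp T 2 μ) (ht : 0 ≤ t) (hρ : ρ < 1)
    (hvar : ∫ ω, T ω ^ 2 ∂μ ≤ ρ * t ^ 2) (g : ℝ) :
    rhoEssSup μ ρ (fun ω => (g + T ω) ^ 2) ≤ (|g| + t) ^ 2 := by
  refine rhoEssSup_le (.of_forall fun _ => sq_nonneg _) hρ
    ((measure_mono fun ω hω => ?_).trans (measure_setOf_lt_abs_le hT ht hvar))
  by_contra hle
  exact (sq_add_le_sq_add_sq g (not_lt.1 hle)).not_gt hω

theorem sq_sub_le_rhoEssSup_sq_add {t p : ℝ} (hT : MemLp T 2 μ) (hb : ∀ᵐ ω ∂μ, |T ω| ≤ b)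
    (ht : 0 ≤ t) (hp : 0 ≤ p) (hρ : 0 ≤ ρ) (hpρ : p + ρ < 1)
    (hvar : ∫ ω, T ω ^ 2 ∂μ ≤ p * t ^ 2) (g : ℝ) :
    g ^ 2 - 2 * |g| * t ≤ rhoEssSup μ ρ (fun ω => (g + T ω) ^ 2) := by
  have hsub : {ω | (g + T ω) ^ 2 < g ^ 2 - 2 * |g| * t} ⊆ {ω | t < |T ω|} := by
    intro ω hω
    by_contra hle
    have hcross : |2 * g * T ω| ≤ 2 * |g| * t := by
      rw [abs_mul, abs_mul, abs_two]
      gcongr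
      exact not_lt.1 hle
    have hge : g ^ 2 - 2 * |g| * t ≤ (g + T ω) ^ 2 := by
      linarith [neg_abs_le (2 * g * T ω), sq_nonneg (T ω), add_sq g (T ω)]
    exact hge.not_gt hω
  refine le_rhoEssSup (hb.mono fun _ h => sq_add_le_sq_add_sq g h) ?_
  calc μ {ω | (g + T ω) ^ 2 < g ^ 2 - 2 * |g| * t} + ENNReal.ofReal ρ
      ≤ ENNReal.ofReal p + ENNReal.ofReal ρ := by
        gcongr
        exact (measure_mono hsub).trans (measure_setOf_lt_abs_le hT ht hvar)
    _ = ENNReal.ofReal (p + ρ) := (ENNReal.ofReal_add hp hρ).symm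
    _ < 1 := ENNReal.ofReal_lt_one.2 hpρ

/-- A probability `p` such that an event of probability at most `p` spoils neither the upper nor
the lower estimate of a `ρ`-essential supremum: `0 < p ≤ ρ`, and `p + ρ < 1` if `ρ < 1`. At
`ρ = 1`, where the mean replaces the essential supremum, the value `1` makes
`∫ T ^ 2 ≤ negligibleLevel ρ * t ^ 2` a plain second moment bound. -/
noncomputable def negligibleLevel (ρ : ℝ) : ℝ :=
  open Classical in if ρ = 1 then 1 else min ρ ((1 - ρ) / 2)

theorem negligibleLevel_one : negligibleLevel 1 = 1 := if_pos rfl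

theorem negligibleLevel_of_ne_one (hρ : ρ ≠ 1) : negligibleLevel ρ = min ρ ((1 - ρ) / 2) :=
  if_neg hρ

theorem negligibleLevel_pos (h0 : 0 < ρ) (h1 : ρ ≤ 1) : 0 < negligibleLevel ρ := by
  rcases h1.eq_or_lt with rfl | hlt
  · exact zero_lt_one.trans_eq negligibleLevel_one.symm
  · rw [negligibleLevel_of_ne_one hlt.ne]
    exact lt_min h0 (by linarith)

theorem abs_tolerantSup_sq_add_sub_sq_le {t : ℝ} (hT : AEStronglyMeasurable T μ)
    (hb : ∀ᵐ ω ∂μ, |T ω| ≤ b) (ht : 0 ≤ t) (h0 : 0 < ρ) (h1 : ρ ≤ 1)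
    (hvar : ∫ ω, T ω ^ 2 ∂μ ≤ negligibleLevel ρ * t ^ 2) (g : ℝ) :
    |tolerantSup μ ρ (fun ω => (g + T ω) ^ 2) - g ^ 2| ≤ 2 * |g| * t + t ^ 2 := by
  have hT2 : MemLp T 2 μ := .of_bound hT b hb
  rcases h1.eq_or_lt with rfl | hlt
  · rw [negligibleLevel_one, one_mul] at hvar
    rw [tolerantSup_one]
    exact abs_integral_sq_add_sub_sq_le hT2 ht hvar g
  · have hmin := negligibleLevel_of_ne_one hlt.ne
    have hle : negligibleLevel ρ ≤ ρ := hmin.trans_le (min_le_left _ _)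
    have hadd : negligibleLevel ρ + ρ < 1 := by
      linarith [hmin.trans_le (min_le_right ρ ((1 - ρ) / 2))]
    have hup := rhoEssSup_sq_add_le hT2 ht hlt (hvar.trans (by gcongr)) g
    have hlow := sq_sub_le_rhoEssSup_sq_add hT2 hb ht (negligibleLevel_pos h0 h1).le h0.le hadd
      hvar g
    rw [add_sq, sq_abs] at hup
    rw [tolerantSup_of_ne_one μ hlt.ne, abs_le]
    exact ⟨by linarith [sq_nonneg t], by linarith⟩

end TolerantSup

section RotationInvariance

variable {E : Type*} [NormedAddCommGroup E] [InnerProductSpace ℝ E] [MeasurableSpace E]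
  [BorelSpace E] {μ : Measure E}

theorem integral_inner_sq_eq_of_norm_eq (hμ : ∀ φ : E ≃ₗᵢ[ℝ] E, MeasurePreserving φ μ μ) {v w : E}
    (h : ‖v‖ = ‖w‖) : ∫ x, inner ℝ v x ^ 2 ∂μ = ∫ x, inner ℝ w x ^ 2 ∂μ := by
  set φ := (ℝ ∙ (v - w))ᗮ.reflection
  have hφ : φ v = w := Submodule.reflection_sub h
  calc ∫ x, inner ℝ v x ^ 2 ∂μ = ∫ x, inner ℝ w (φ x) ^ 2 ∂μ := by
        simp only [← hφ, LinearIsometryEquiv.inner_map_map]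
    _ = ∫ x, inner ℝ w x ^ 2 ∂μ :=
        (hμ φ).integral_comp' (f := φ.toMeasurableEquiv) fun x => inner ℝ w x ^ 2

theorem finrank_mul_integral_inner_sq [FiniteDimensional ℝ E]
    (hμ : ∀ φ : E ≃ₗᵢ[ℝ] E, MeasurePreserving φ μ μ) (hid : MemLp id 2 μ) (v : E) :
    Module.finrank ℝ E * ∫ x, inner ℝ v x ^ 2 ∂μ = ‖v‖ ^ 2 * ∫ x, ‖x‖ ^ 2 ∂μ := by
  set b := stdOrthonormalBasis ℝ E
  have hcoord (i) : ∫ x, inner ℝ v x ^ 2 ∂μ = ‖v‖ ^ 2 * ∫ x, inner ℝ (b i) x ^ 2 ∂μ := by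
    rw [integral_inner_sq_eq_of_norm_eq hμ (w := ‖v‖ • b i) (by simp [norm_smul]),
      ← integral_const_mul]
    simp only [real_inner_smul_left, mul_pow]
  have hint (i) : Integrable (fun x => inner ℝ (b i) x ^ 2) μ :=
    (hid.continuousLinearMap_comp (innerSL ℝ (b i))).integrable_sq
  calc Module.finrank ℝ E * ∫ x, inner ℝ v x ^ 2 ∂μ
      = ∑ i : Fin (Module.finrank ℝ E), ‖v‖ ^ 2 * ∫ x, inner ℝ (b i) x ^ 2 ∂μ := by
        simp [← hcoord]
    _ = ‖v‖ ^ 2 * ∫ x, ∑ i, inner ℝ (b i) x ^ 2 ∂μ := by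
        rw [← Finset.mul_sum, integral_finsetSum _ fun i _ => hint i]
    _ = ‖v‖ ^ 2 * ∫ x, ‖x‖ ^ 2 ∂μ := by simp only [b.sum_sq_inner_right]

end RotationInvariance

section BallUniform

variable {d : ℕ} {ε : ℝ}

theorem isProbabilityMeasure_ballUniform (hε : 0 < ε) : IsProbabilityMeasure (ballUniform d ε) :=
  cond_isProbabilityMeasure_of_finite (Metric.measure_closedBall_pos _ _ hε).ne'
    measure_closedBall_lt_top.ne

theorem ae_norm_le_ballUniform : ∀ᵐ δ ∂ballUniform d ε, ‖δ‖ ≤ ε :=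
  (ae_cond_mem Metric.isClosed_closedBall.measurableSet).mono fun _ => mem_closedBall_zero_iff.1

theorem measurePreserving_ballUniform (φ : Euc d ≃ₗᵢ[ℝ] Euc d) :
    MeasurePreserving φ (ballUniform d ε) (ballUniform d ε) := by
  have hball : φ ⁻¹' Metric.closedBall 0 ε = Metric.closedBall 0 ε := by
    rw [φ.preimage_closedBall, map_zero]
  have hrestrict := φ.measurePreserving.restrict_preimage
    (Metric.isClosed_closedBall (x := 0) (ε := ε)).measurableSet
  rw [hball] at hrestrict
  exact hrestrict.smul_measure _

theorem closedBall_subset_support_ballUniform (hε : ε ≠ 0) :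
    Metric.closedBall 0 ε ⊆ (ballUniform d ε).support := by
  have hac : volume.restrict (Metric.closedBall 0 ε) ≪ ballUniform d ε :=
    Measure.absolutelyContinuous_smul (ENNReal.inv_ne_zero.2 measure_closedBall_lt_top.ne)
  have hball : Metric.ball 0 ε ⊆ (ballUniform d ε).support := fun x hx =>
    hac.support_mono (Measure.interior_inter_support
      ⟨Metric.ball_subset_interior_closedBall hx, by simp [Measure.support_eq_univ]⟩)
  rw [← closure_ball _ hε]
  exact Measure.isClosed_support.closure_subset_iff.2 hball

theorem abs_linHyp_le {δ : Euc d} (θ : Euc d) (hδ : ‖δ‖ ≤ ε) : |linHyp θ δ| ≤ ε * ‖θ‖ :=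
  calc |linHyp θ δ| ≤ ‖θ‖ * ‖δ‖ := abs_real_inner_le_norm θ δ
    _ ≤ ε * ‖θ‖ := by rw [mul_comm]; gcongr

@[fun_prop]
theorem continuous_linHyp (θ : Euc d) : Continuous (linHyp θ) :=
  continuous_const.inner continuous_id

theorem integral_linHyp_sq_ballUniform_le (hd : 0 < d) (hε : 0 < ε) (θ : Euc d) :
    ∫ δ, linHyp θ δ ^ 2 ∂ballUniform d ε ≤ ε ^ 2 * ‖θ‖ ^ 2 / d := by
  have := isProbabilityMeasure_ballUniform (d := d) hε
  have hid : MemLp id 2 (ballUniform d ε) :=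
    .of_bound aestronglyMeasurable_id ε ae_norm_le_ballUniform
  have hnorm : ∫ δ, ‖δ‖ ^ 2 ∂ballUniform d ε ≤ ε ^ 2 := by
    have hle : ∀ᵐ δ ∂ballUniform d ε, ‖δ‖ ^ 2 ≤ ε ^ 2 :=
      ae_norm_le_ballUniform.mono fun δ hδ => by gcongr
    simpa using integral_mono_ae hid.norm.integrable_sq (integrable_const (ε ^ 2)) hle
  rw [le_div_iff₀' (Nat.cast_pos.2 hd)]
  calc d * ∫ δ, linHyp θ δ ^ 2 ∂ballUniform d ε
      = ‖θ‖ ^ 2 * ∫ δ, ‖δ‖ ^ 2 ∂ballUniform d ε := by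
        simpa only [finrank_euclideanSpace_fin, linHyp] using
          finrank_mul_integral_inner_sq measurePreserving_ballUniform hid θ
    _ ≤ ε ^ 2 * ‖θ‖ ^ 2 := by rw [mul_comm]; gcongr

end BallUniform

section LinearHypothesis

variable {d : ℕ} {D : Measure (Euc d × ℝ)} {r : Measure (Euc d)} {θ : Euc d}
  {ε ρ η : ℝ}

theorem probRobustLoss_linHyp (r : Measure (Euc d)) (ρ : ℝ) (θ : Euc d) (p : Euc d × ℝ) :
    probRobustLoss r ρ (linHyp θ) p =
      tolerantSup r ρ fun δ => (linHyp θ p.1 - p.2 + linHyp θ δ) ^ 2 := by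
  have hloss (δ : Euc d) :
      sqLoss (linHyp θ (p.1 + δ)) p.2 = (linHyp θ p.1 - p.2 + linHyp θ δ) ^ 2 := by
    simp only [sqLoss, linHyp, inner_add_right]
    ring
  simp only [probRobustLoss, tolerantSup, hloss]

theorem ae_sq_residual_add_le (hr : ∀ᵐ δ ∂r, ‖δ‖ ≤ ε) (θ : Euc d) (p : Euc d × ℝ) :
    ∀ᵐ δ ∂r, (linHyp θ p.1 - p.2 + linHyp θ δ) ^ 2 ≤ (|linHyp θ p.1 - p.2| + ε * ‖θ‖) ^ 2 :=
  hr.mono fun _ hδ => sq_add_le_sq_add_sq _ (abs_linHyp_le θ hδ)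

theorem le_probRobustLoss_zero_linHyp (hr : ∀ᵐ δ ∂r, ‖δ‖ ≤ ε) {δ : Euc d} (hδ : δ ∈ r.support)
    (θ : Euc d) (p : Euc d × ℝ) :
    (linHyp θ p.1 - p.2 + linHyp θ δ) ^ 2 ≤ probRobustLoss r 0 (linHyp θ) p := by
  rw [probRobustLoss_linHyp, tolerantSup_of_ne_one r zero_ne_one]
  exact le_rhoEssSup_zero_of_mem_support (by fun_prop) (ae_sq_residual_add_le hr θ p) hδ

theorem exists_mem_closedBall_linHyp_eq (hε : 0 ≤ ε) (θ : Euc d) :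
    ∃ δ ∈ Metric.closedBall (0 : Euc d) ε, linHyp θ δ = ε * ‖θ‖ := by
  refine ⟨(ε / ‖θ‖) • θ, mem_closedBall_zero_iff.2 ?_, ?_⟩
  · rw [norm_smul, norm_div, norm_norm, Real.norm_of_nonneg hε]
    exact mul_le_of_le_div₀ hε (norm_nonneg θ) le_rfl
  · rcases eq_or_ne θ 0 with rfl | hθ
    · simp [linHyp]
    · have := norm_ne_zero_iff.2 hθ
      rw [linHyp, real_inner_smul_right, real_inner_self_eq_norm_sq]
      field_simp

variable [IsProbabilityMeasure r]

theorem probRobustLoss_linHyp_nonneg (hr : ∀ᵐ δ ∂r, ‖δ‖ ≤ ε) (hρ : ρ ≤ 1) (θ : Euc d)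
    (p : Euc d × ℝ) : 0 ≤ probRobustLoss r ρ (linHyp θ) p := by
  rw [probRobustLoss_linHyp]
  exact tolerantSup_nonneg (.of_forall fun _ => sq_nonneg _) (ae_sq_residual_add_le hr θ p) hρ

theorem probRobustLoss_linHyp_le (hr : ∀ᵐ δ ∂r, ‖δ‖ ≤ ε) (hρ : ρ ≤ 1) (θ : Euc d)
    (p : Euc d × ℝ) :
    probRobustLoss r ρ (linHyp θ) p ≤ (|linHyp θ p.1 - p.2| + ε * ‖θ‖) ^ 2 := by
  rw [probRobustLoss_linHyp]
  exact tolerantSup_le (.of_forall fun _ => sq_nonneg _) (ae_sq_residual_add_le hr θ p) hρ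

theorem probRobustRisk_linHyp_nonneg (hr : ∀ᵐ δ ∂r, ‖δ‖ ≤ ε) (hρ : ρ ≤ 1) (θ : Euc d) :
    0 ≤ probRobustRisk D r ρ (linHyp θ) :=
  integral_nonneg (probRobustLoss_linHyp_nonneg hr hρ θ)

theorem integrable_probRobustLoss_linHyp [IsFiniteMeasure D] (hr : ∀ᵐ δ ∂r, ‖δ‖ ≤ ε) (hρ : ρ ≤ 1)
    (hD : MemLp (fun p : Euc d × ℝ => linHyp θ p.1 - p.2) 2 D) :
    Integrable (probRobustLoss r ρ (linHyp θ)) D := by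
  have hbound : Integrable (fun p => (|linHyp θ p.1 - p.2| + ε * ‖θ‖) ^ 2) D :=
    (hD.abs.add (memLp_const _)).integrable_sq
  have hcont := continuous_tolerantSup_sq (continuous_linHyp θ).aestronglyMeasurable
    (hr.mono fun _ hδ => abs_linHyp_le θ hδ) hρ
  refine hbound.mono' ?_ (.of_forall fun p => ?_)
  · simpa only [← probRobustLoss_linHyp] using hcont.comp_aestronglyMeasurable hD.1
  · rw [Real.norm_of_nonneg (probRobustLoss_linHyp_nonneg hr hρ θ p)]
    exact probRobustLoss_linHyp_le hr hρ θ p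

theorem abs_probRobustLoss_sub_sqLoss_le (hr : ∀ᵐ δ ∂r, ‖δ‖ ≤ ε) (h0 : 0 < ρ) (h1 : ρ ≤ 1)
    (hη : 0 ≤ η) (hvar : ∫ δ, linHyp θ δ ^ 2 ∂r ≤ negligibleLevel ρ * (η * ‖θ‖) ^ 2)
    (p : Euc d × ℝ) :
    |probRobustLoss r ρ (linHyp θ) p - sqLoss (linHyp θ p.1) p.2| ≤
      η * sqLoss (linHyp θ p.1) p.2 + (η * ‖θ‖ ^ 2 + η ^ 2 * ‖θ‖ ^ 2) := by
  rw [probRobustLoss_linHyp, sqLoss]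
  set g := linHyp θ p.1 - p.2
  calc |tolerantSup r ρ (fun δ => (g + linHyp θ δ) ^ 2) - g ^ 2|
      ≤ 2 * |g| * (η * ‖θ‖) + (η * ‖θ‖) ^ 2 :=
        abs_tolerantSup_sq_add_sub_sq_le (continuous_linHyp θ).aestronglyMeasurable
          (hr.mono fun _ hδ => abs_linHyp_le θ hδ) (by positivity) h0 h1 hvar g
    _ = η * (2 * |g| * ‖θ‖) + η ^ 2 * ‖θ‖ ^ 2 := by ring
    _ ≤ η * (|g| ^ 2 + ‖θ‖ ^ 2) + η ^ 2 * ‖θ‖ ^ 2 := by gcongr; exact two_mul_le_add_sq _ _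
    _ = η * g ^ 2 + (η * ‖θ‖ ^ 2 + η ^ 2 * ‖θ‖ ^ 2) := by rw [sq_abs]; ring

theorem abs_probRobustRisk_sub_nominalRisk_le [IsProbabilityMeasure D]
    (hr : ∀ᵐ δ ∂r, ‖δ‖ ≤ ε) (h0 : 0 < ρ) (h1 : ρ ≤ 1) (hη : 0 ≤ η)
    (hvar : ∫ δ, linHyp θ δ ^ 2 ∂r ≤ negligibleLevel ρ * (η * ‖θ‖) ^ 2)
    (hD : MemLp (fun p : Euc d × ℝ => linHyp θ p.1 - p.2) 2 D) :
    |probRobustRisk D r ρ (linHyp θ) - nominalRisk D (linHyp θ)| ≤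
      η * (nominalRisk D (linHyp θ) + ‖θ‖ ^ 2) + η ^ 2 * ‖θ‖ ^ 2 := by
  have hsq : Integrable (fun p => sqLoss (linHyp θ p.1) p.2) D := hD.integrable_sq
  have hbound : Integrable
      (fun p => η * sqLoss (linHyp θ p.1) p.2 + (η * ‖θ‖ ^ 2 + η ^ 2 * ‖θ‖ ^ 2)) D :=
    (hsq.const_mul η).add (integrable_const _)
  calc |probRobustRisk D r ρ (linHyp θ) - nominalRisk D (linHyp θ)|
      = |∫ p, (probRobustLoss r ρ (linHyp θ) p - sqLoss (linHyp θ p.1) p.2) ∂D| := by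
        rw [integral_sub (integrable_probRobustLoss_linHyp hr h1 hD) hsq, probRobustRisk,
          nominalRisk]
    _ ≤ ∫ p, (η * sqLoss (linHyp θ p.1) p.2 + (η * ‖θ‖ ^ 2 + η ^ 2 * ‖θ‖ ^ 2)) ∂D := by
        rw [← Real.norm_eq_abs]
        exact norm_integral_le_of_norm_le hbound
          (.of_forall (abs_probRobustLoss_sub_sqLoss_le hr h0 h1 hη hvar))
    _ = η * (nominalRisk D (linHyp θ) + ‖θ‖ ^ 2) + η ^ 2 * ‖θ‖ ^ 2 := by
        rw [integral_add (hsq.const_mul η) (integrable_const _), integral_const_mul,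
          integral_const, probReal_univ, one_smul, nominalRisk]
        ring

theorem probRobustLoss_zero_linHyp (hε : 0 ≤ ε) (hr : ∀ᵐ δ ∂r, ‖δ‖ ≤ ε)
    (hsupp : Metric.closedBall 0 ε ⊆ r.support) (θ : Euc d) (p : Euc d × ℝ) :
    probRobustLoss r 0 (linHyp θ) p = (|linHyp θ p.1 - p.2| + ε * ‖θ‖) ^ 2 := by
  refine (probRobustLoss_linHyp_le hr zero_le_one θ p).antisymm ?_
  obtain ⟨δ, hδ, hval⟩ := exists_mem_closedBall_linHyp_eq hε θ
  rcases abs_cases (linHyp θ p.1 - p.2) with ⟨habs, -⟩ | ⟨habs, -⟩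
  · have h := le_probRobustLoss_zero_linHyp hr (hsupp hδ) θ p
    rwa [habs, ← hval]
  · have hneg : -δ ∈ Metric.closedBall (0 : Euc d) ε := by simpa using hδ
    have h := le_probRobustLoss_zero_linHyp hr (hsupp hneg) θ p
    rw [linHyp, linHyp, inner_neg_right, ← linHyp, ← linHyp, hval] at h
    rwa [habs, ← neg_sq, neg_add, neg_neg]

theorem nominalRisk_add_le_probRobustRisk_zero [IsProbabilityMeasure D] (hε : 0 ≤ ε)
    (hr : ∀ᵐ δ ∂r, ‖δ‖ ≤ ε) (hsupp : Metric.closedBall 0 ε ⊆ r.support)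
    (hD : MemLp (fun p : Euc d × ℝ => linHyp θ p.1 - p.2) 2 D) :
    nominalRisk D (linHyp θ) + ε ^ 2 * ‖θ‖ ^ 2 ≤ probRobustRisk D r 0 (linHyp θ) := by
  have hsq : Integrable (fun p => sqLoss (linHyp θ p.1) p.2) D := hD.integrable_sq
  calc nominalRisk D (linHyp θ) + ε ^ 2 * ‖θ‖ ^ 2
      = ∫ p, (sqLoss (linHyp θ p.1) p.2 + ε ^ 2 * ‖θ‖ ^ 2) ∂D := by
        rw [integral_add hsq (integrable_const _), integral_const, probReal_univ, one_smul,
          nominalRisk]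
    _ ≤ probRobustRisk D r 0 (linHyp θ) := by
        refine integral_mono (hsq.add (integrable_const _))
          (integrable_probRobustLoss_linHyp hr zero_le_one hD) fun p => ?_
        simp only [probRobustLoss_zero_linHyp hε hr hsupp, sqLoss]
        have hcross : 0 ≤ 2 * |linHyp θ p.1 - p.2| * (ε * ‖θ‖) := by positivity
        linarith [add_sq |linHyp θ p.1 - p.2| (ε * ‖θ‖), sq_abs (linHyp θ p.1 - p.2),
          mul_pow ε ‖θ‖ 2]

theorem probRobustRisk_le_two_mul [IsProbabilityMeasure D] (hr : ∀ᵐ δ ∂r, ‖δ‖ ≤ ε) (hρ : ρ ≤ 1)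
    (hD : MemLp (fun p : Euc d × ℝ => linHyp θ p.1 - p.2) 2 D) :
    probRobustRisk D r ρ (linHyp θ) ≤ 2 * (nominalRisk D (linHyp θ) + ε ^ 2 * ‖θ‖ ^ 2) := by
  have hsq : Integrable (fun p => sqLoss (linHyp θ p.1) p.2) D := hD.integrable_sq
  calc probRobustRisk D r ρ (linHyp θ)
      ≤ ∫ p, 2 * (sqLoss (linHyp θ p.1) p.2 + ε ^ 2 * ‖θ‖ ^ 2) ∂D := by
        refine integral_mono (integrable_probRobustLoss_linHyp hr hρ hD)
          ((hsq.add (integrable_const _)).const_mul 2) fun p => ?_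
        refine (probRobustLoss_linHyp_le hr hρ θ p).trans (add_sq_le.trans_eq ?_)
        rw [sq_abs, mul_pow, sqLoss]
    _ = 2 * (nominalRisk D (linHyp θ) + ε ^ 2 * ‖θ‖ ^ 2) := by
        rw [integral_const_mul, integral_add hsq (integrable_const _), integral_const,
          probReal_univ, one_smul, nominalRisk]

theorem linHyp_sub_snd_eq (θ₀ θ : Euc d) (p : Euc d × ℝ) :
    linHyp θ p.1 - p.2 = linHyp (θ - θ₀) p.1 - (p.2 - linHyp θ₀ p.1) := by
  simp only [linHyp, inner_sub_left]
  ring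

end LinearHypothesis

/-- A law of `(x, y)` with the second moments of the model `y = θ₀ᵀ x + z`, where `x` is isotropic,
`z` has second moment `σ²`, and `x` and `z` are uncorrelated. The bounds on the robust risk need no
other property of the Gaussian law `linRegLaw θ₀ σ`. -/
structure IsIsotropicLinearModel {d : ℕ} (D : Measure (Euc d × ℝ)) (θ₀ : Euc d) (σ : ℝ) :
    Prop where
  memLp_linHyp (v : Euc d) : MemLp (fun p => linHyp v p.1) 2 D
  memLp_noise : MemLp (fun p : Euc d × ℝ => p.2 - linHyp θ₀ p.1) 2 D
  integral_linHyp_sq (v : Euc d) : ∫ p, linHyp v p.1 ^ 2 ∂D = ‖v‖ ^ 2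
  integral_noise_sq : ∫ p, (p.2 - linHyp θ₀ p.1) ^ 2 ∂D = σ ^ 2
  integral_linHyp_mul_noise (v : Euc d) : ∫ p, linHyp v p.1 * (p.2 - linHyp θ₀ p.1) ∂D = 0

namespace IsIsotropicLinearModel

variable {d : ℕ} {D : Measure (Euc d × ℝ)} {θ₀ : Euc d} {σ : ℝ}

theorem memLp_residual (h : IsIsotropicLinearModel D θ₀ σ) (θ : Euc d) :
    MemLp (fun p : Euc d × ℝ => linHyp θ p.1 - p.2) 2 D := by
  simp only [linHyp_sub_snd_eq θ₀ θ]
  exact (h.memLp_linHyp _).sub h.memLp_noise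

theorem nominalRisk_linHyp (h : IsIsotropicLinearModel D θ₀ σ) (θ : Euc d) :
    nominalRisk D (linHyp θ) = ‖θ - θ₀‖ ^ 2 + σ ^ 2 := by
  have hcross : Integrable
      (fun p : Euc d × ℝ => 2 * (linHyp (θ - θ₀) p.1 * (p.2 - linHyp θ₀ p.1))) D :=
    ((h.memLp_linHyp _).integrable_mul h.memLp_noise).const_mul 2
  have hdiff : Integrable (fun p : Euc d × ℝ =>
      linHyp (θ - θ₀) p.1 ^ 2 - 2 * (linHyp (θ - θ₀) p.1 * (p.2 - linHyp θ₀ p.1))) D :=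
    (h.memLp_linHyp _).integrable_sq.sub hcross
  have hexpand (p : Euc d × ℝ) : sqLoss (linHyp θ p.1) p.2 = linHyp (θ - θ₀) p.1 ^ 2 -
      2 * (linHyp (θ - θ₀) p.1 * (p.2 - linHyp θ₀ p.1)) + (p.2 - linHyp θ₀ p.1) ^ 2 := by
    rw [sqLoss, linHyp_sub_snd_eq θ₀ θ, sub_sq, mul_assoc]
  simp only [nominalRisk, hexpand]
  rw [integral_add hdiff h.memLp_noise.integrable_sq,
    integral_sub (h.memLp_linHyp _).integrable_sq hcross, integral_const_mul,
    h.integral_linHyp_sq, h.integral_linHyp_mul_noise, h.integral_noise_sq, mul_zero, sub_zero]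

theorem nominalRisk_linHyp_self (h : IsIsotropicLinearModel D θ₀ σ) :
    nominalRisk D (linHyp θ₀) = σ ^ 2 := by
  simp [h.nominalRisk_linHyp]

variable [IsProbabilityMeasure D] {r : Measure (Euc d)} [IsProbabilityMeasure r] {ε ρ η R : ℝ}
  {θ : Euc d}

theorem abs_probRobustRisk_sub_sq_le_of_le (h : IsIsotropicLinearModel D θ₀ σ)
    (hr : ∀ᵐ δ ∂r, ‖δ‖ ≤ ε) (h0 : 0 < ρ) (h1 : ρ ≤ 1) (hη : 0 ≤ η)
    (hvar : ∀ v, ∫ δ, linHyp v δ ^ 2 ∂r ≤ negligibleLevel ρ * (η * ‖v‖) ^ 2)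
    (hθ : probRobustRisk D r ρ (linHyp θ) ≤ probRobustRisk D r ρ (linHyp θ₀)) :
    |probRobustRisk D r ρ (linHyp θ) - σ ^ 2| ≤
      η * (4 * σ ^ 2 + 2 * (1 + η) * ‖θ₀‖ ^ 2) := by
  have hgap (v : Euc d) := abs_le.1
    (abs_probRobustRisk_sub_nominalRisk_le hr h0 h1 hη (hvar v) (h.memLp_residual v))
  have hupper := (hgap θ₀).2
  rw [h.nominalRisk_linHyp_self] at hupper
  have hσ : 0 ≤ η * σ ^ 2 := by positivity
  have hθ₀ : 0 ≤ (η + η ^ 2) * ‖θ₀‖ ^ 2 := by positivity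
  rw [abs_le]
  refine ⟨?_, by linarith⟩
  -- For `η ≤ 1 / 4` the excess `‖θ - θ₀‖²` of the nominal risk absorbs the error terms in `‖θ‖²`;
  -- for larger `η` the right-hand side already exceeds `σ²`.
  rcases le_total η (1 / 4) with hsmall | hlarge
  · have hlower := (hgap θ).1
    rw [h.nominalRisk_linHyp] at hlower
    have hnorm : ‖θ‖ ^ 2 ≤ 2 * (‖θ - θ₀‖ ^ 2 + ‖θ₀‖ ^ 2) := by
      have htri : ‖θ‖ ≤ ‖θ - θ₀‖ + ‖θ₀‖ := by simpa using norm_add_le (θ - θ₀) θ₀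
      exact (pow_le_pow_left₀ (norm_nonneg θ) htri 2).trans add_sq_le
    have hdecay : (η + η ^ 2) * ‖θ‖ ^ 2 ≤
        (η + η ^ 2) * (2 * (‖θ - θ₀‖ ^ 2 + ‖θ₀‖ ^ 2)) := by gcongr
    have hexcess : 0 ≤ (1 - 3 * η - 2 * η ^ 2) * ‖θ - θ₀‖ ^ 2 :=
      mul_nonneg (by nlinarith) (sq_nonneg _)
    linarith
  · have hnonneg := probRobustRisk_linHyp_nonneg (D := D) hr h1 θ
    have hnoise : 0 ≤ (4 * η - 1) * σ ^ 2 := mul_nonneg (by linarith) (sq_nonneg σ)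
    linarith

theorem abs_probRobustRisk_ballUniform_sub_sq_le (h : IsIsotropicLinearModel D θ₀ σ) (hd : 0 < d)
    (hε : 0 < ε) (h0 : 0 < ρ) (h1 : ρ ≤ 1) (hR : ‖θ₀‖ ≤ R)
    (hθ : probRobustRisk D (ballUniform d ε) ρ (linHyp θ) ≤
      probRobustRisk D (ballUniform d ε) ρ (linHyp θ₀)) :
    |probRobustRisk D (ballUniform d ε) ρ (linHyp θ) - σ ^ 2| ≤
      ε / √(negligibleLevel ρ) * (4 * σ ^ 2 + 2 * (1 + ε / √(negligibleLevel ρ)) * R ^ 2) /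
        √d := by
  have := isProbabilityMeasure_ballUniform (d := d) hε
  have hd1 : (1 : ℝ) ≤ √d := Real.one_le_sqrt.2 (Nat.one_le_cast.2 hd)
  have hlevel := negligibleLevel_pos h0 h1
  set K := ε / √(negligibleLevel ρ) with hK
  have hKpos : 0 ≤ K := by positivity
  have hvar (v : Euc d) : ∫ δ, linHyp v δ ^ 2 ∂ballUniform d ε ≤
      negligibleLevel ρ * (K / √d * ‖v‖) ^ 2 := by
    refine (integral_linHyp_sq_ballUniform_le hd hε v).trans_eq ?_
    rw [hK, mul_pow, div_pow, div_pow, Real.sq_sqrt hlevel.le, Real.sq_sqrt (Nat.cast_nonneg d)]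
    field_simp
  calc |probRobustRisk D (ballUniform d ε) ρ (linHyp θ) - σ ^ 2|
      ≤ K / √d * (4 * σ ^ 2 + 2 * (1 + K / √d) * ‖θ₀‖ ^ 2) :=
        h.abs_probRobustRisk_sub_sq_le_of_le ae_norm_le_ballUniform h0 h1 (by positivity)
          hvar hθ
    _ ≤ K / √d * (4 * σ ^ 2 + 2 * (1 + K) * R ^ 2) := by
        gcongr
        exact div_le_self hKpos hd1
    _ = K * (4 * σ ^ 2 + 2 * (1 + K) * R ^ 2) / √d := by ring

theorem le_probRobustRisk_zero_sub_sq (h : IsIsotropicLinearModel D θ₀ σ) (hε : 0 ≤ ε)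
    (hr : ∀ᵐ δ ∂r, ‖δ‖ ≤ ε) (hsupp : Metric.closedBall 0 ε ⊆ r.support) (θ : Euc d) :
    ε ^ 2 / (1 + ε ^ 2) * ‖θ₀‖ ^ 2 ≤ probRobustRisk D r 0 (linHyp θ) - σ ^ 2 := by
  have hrisk := nominalRisk_add_le_probRobustRisk_zero hε hr hsupp (h.memLp_residual θ)
  rw [h.nominalRisk_linHyp] at hrisk
  have hsquare : (1 + ε ^ 2) * (‖θ - θ₀‖ ^ 2 + ε ^ 2 * ‖θ‖ ^ 2) - ε ^ 2 * ‖θ₀‖ ^ 2 =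
      ‖(1 + ε ^ 2) • θ - θ₀‖ ^ 2 := by
    rw [norm_sub_sq_real, norm_sub_sq_real, norm_smul, real_inner_smul_left,
      Real.norm_of_nonneg (by positivity)]
    ring
  have hpos : 0 < 1 + ε ^ 2 := by positivity
  rw [div_mul_eq_mul_div, div_le_iff₀' hpos]
  calc ε ^ 2 * ‖θ₀‖ ^ 2 ≤ (1 + ε ^ 2) * (‖θ - θ₀‖ ^ 2 + ε ^ 2 * ‖θ‖ ^ 2) := by
        linarith [sq_nonneg ‖(1 + ε ^ 2) • θ - θ₀‖]
    _ ≤ (1 + ε ^ 2) * (probRobustRisk D r 0 (linHyp θ) - σ ^ 2) := by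
        gcongr
        linarith

theorem abs_probRobustRisk_zero_sub_sq_le (h : IsIsotropicLinearModel D θ₀ σ) (hε : 0 ≤ ε)
    (hr : ∀ᵐ δ ∂r, ‖δ‖ ≤ ε) (hsupp : Metric.closedBall 0 ε ⊆ r.support) (hR : ‖θ₀‖ ≤ R)
    (hθ : probRobustRisk D r 0 (linHyp θ) ≤ probRobustRisk D r 0 (linHyp θ₀)) :
    |probRobustRisk D r 0 (linHyp θ) - σ ^ 2| ≤ σ ^ 2 + 2 * ε ^ 2 * R ^ 2 := by
  have hlower : 0 ≤ probRobustRisk D r 0 (linHyp θ) - σ ^ 2 :=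
    le_trans (by positivity) (h.le_probRobustRisk_zero_sub_sq hε hr hsupp θ)
  have hupper := probRobustRisk_le_two_mul hr zero_le_one (h.memLp_residual θ₀)
  rw [h.nominalRisk_linHyp_self] at hupper
  have hnorm : ε ^ 2 * ‖θ₀‖ ^ 2 ≤ ε ^ 2 * R ^ 2 := by gcongr
  rw [abs_of_nonneg hlower]
  linarith

end IsIsotropicLinearModel

section GaussianModel

variable {d : ℕ}

theorem memLp_linHyp_stdGaussian (v : Euc d) : MemLp (linHyp v) 2 (stdGaussian (Euc d)) :=
  IsGaussian.memLp_two_id.continuousLinearMap_comp (innerSL ℝ v)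

theorem integral_linHyp_stdGaussian (v : Euc d) : ∫ x, linHyp v x ∂stdGaussian (Euc d) = 0 :=
  integral_strongDual_stdGaussian (innerSL ℝ v)

theorem integral_linHyp_sq_stdGaussian (v : Euc d) :
    ∫ x, linHyp v x ^ 2 ∂stdGaussian (Euc d) = ‖v‖ ^ 2 := by
  have hvar := variance_dual_stdGaussian (innerSL ℝ v)
  rw [innerSL_apply_norm] at hvar
  rw [← hvar, variance_of_integral_eq_zero (innerSL ℝ v).continuous.aemeasurable
    (integral_linHyp_stdGaussian v)]
  rfl

theorem integral_sq_gaussianReal_zero (s : NNReal) : ∫ z, z ^ 2 ∂gaussianReal 0 s = s := by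
  rw [← variance_id_gaussianReal (μ := 0) (v := s), variance_of_integral_eq_zero aemeasurable_id
    integral_id_gaussianReal]
  rfl

theorem measurable_linReg (θ₀ : Euc d) :
    Measurable fun p : Euc d × ℝ => (p.1, inner ℝ θ₀ p.1 + p.2) := by
  fun_prop

instance isProbabilityMeasure_linRegLaw (θ₀ : Euc d) (σ : ℝ) :
    IsProbabilityMeasure (linRegLaw θ₀ σ) :=
  Measure.isProbabilityMeasure_map (measurable_linReg θ₀).aemeasurable

theorem integral_linRegLaw {θ₀ : Euc d} {σ : ℝ} {f : Euc d × ℝ → ℝ} (hf : Continuous f) :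
    ∫ p, f p ∂linRegLaw θ₀ σ =
      ∫ p, f (p.1, inner ℝ θ₀ p.1 + p.2)
        ∂(stdGaussian (Euc d)).prod (gaussianReal 0 (σ ^ 2).toNNReal) :=
  integral_map (measurable_linReg θ₀).aemeasurable hf.aestronglyMeasurable

theorem memLp_linRegLaw_iff {θ₀ : Euc d} {σ : ℝ} {f : Euc d × ℝ → ℝ} (hf : Continuous f) :
    MemLp f 2 (linRegLaw θ₀ σ) ↔
      MemLp (fun p => f (p.1, inner ℝ θ₀ p.1 + p.2)) 2
        ((stdGaussian (Euc d)).prod (gaussianReal 0 (σ ^ 2).toNNReal)) :=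
  memLp_map_measure_iff hf.aestronglyMeasurable (measurable_linReg θ₀).aemeasurable

theorem isIsotropicLinearModel_linRegLaw (θ₀ : Euc d) (σ : ℝ) :
    IsIsotropicLinearModel (linRegLaw θ₀ σ) θ₀ σ := by
  have hcancel (p : Euc d × ℝ) : inner ℝ θ₀ p.1 + p.2 - linHyp θ₀ p.1 = p.2 :=
    add_sub_cancel_left _ _
  refine ⟨fun v => ?_, ?_, fun v => ?_, ?_, fun v => ?_⟩
  · rw [memLp_linRegLaw_iff (by fun_prop)]
    exact (memLp_linHyp_stdGaussian v).comp_fst _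
  · rw [memLp_linRegLaw_iff (by fun_prop)]
    simp only [hcancel]
    exact (memLp_id_gaussianReal' 2 ENNReal.ofNat_ne_top).comp_snd _
  · rw [integral_linRegLaw (f := fun p => linHyp v p.1 ^ 2) (by fun_prop),
      integral_fun_fst fun x => linHyp v x ^ 2, integral_linHyp_sq_stdGaussian, probReal_univ,
      one_smul]
  · rw [integral_linRegLaw (f := fun p => (p.2 - linHyp θ₀ p.1) ^ 2) (by fun_prop)]
    simp only [hcancel]
    rw [integral_fun_snd fun z : ℝ => z ^ 2, integral_sq_gaussianReal_zero, probReal_univ,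
      one_smul, Real.coe_toNNReal _ (sq_nonneg σ)]
  · rw [integral_linRegLaw (f := fun p => linHyp v p.1 * (p.2 - linHyp θ₀ p.1)) (by fun_prop)]
    simp only [hcancel]
    rw [integral_prod_mul (linHyp v) fun z : ℝ => z, integral_linHyp_stdGaussian, zero_mul]

end GaussianModel

theorem mainTheorem3_general (σ ε R : ℝ) (hε : 0 < ε) :
    (∀ (d : ℕ) (D : Measure (Euc d × ℝ)) [IsProbabilityMeasure D] (θ₀ θ : Euc d),
      IsIsotropicLinearModel D θ₀ σ →
        Integrable (fun p => sqLoss (linHyp θ p.1) p.2) D ∧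
        (∀ ρ ∈ Set.Icc (0 : ℝ) 1, Integrable (probRobustLoss (ballUniform d ε) ρ (linHyp θ)) D) ∧
        nominalRisk D (linHyp θ₀) = σ ^ 2 ∧
        nominalRisk D (linHyp θ₀) ≤ nominalRisk D (linHyp θ)) ∧
    (∀ ρ ∈ Set.Ioc (0 : ℝ) 1, ∃ C : ℝ, ∀ (d : ℕ), 0 < d →
      ∀ (D : Measure (Euc d × ℝ)) [IsProbabilityMeasure D] (θ₀ θ : Euc d),
        IsIsotropicLinearModel D θ₀ σ → ‖θ₀‖ ≤ R →
        probRobustRisk D (ballUniform d ε) ρ (linHyp θ) ≤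
          probRobustRisk D (ballUniform d ε) ρ (linHyp θ₀) →
        |probRobustRisk D (ballUniform d ε) ρ (linHyp θ) - nominalRisk D (linHyp θ₀)| ≤
          C / √d) ∧
    (∃ C : ℝ, ∀ (d : ℕ) (D : Measure (Euc d × ℝ)) [IsProbabilityMeasure D] (θ₀ θ : Euc d),
      IsIsotropicLinearModel D θ₀ σ → ‖θ₀‖ ≤ R →
      probRobustRisk D (ballUniform d ε) 0 (linHyp θ) ≤
        probRobustRisk D (ballUniform d ε) 0 (linHyp θ₀) →
      |probRobustRisk D (ballUniform d ε) 0 (linHyp θ) - nominalRisk D (linHyp θ₀)| ≤ C) ∧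
    (∀ r : ℝ, 0 < r → ∃ c : ℝ, 0 < c ∧
      ∀ (d : ℕ) (D : Measure (Euc d × ℝ)) [IsProbabilityMeasure D] (θ₀ θ : Euc d),
        IsIsotropicLinearModel D θ₀ σ → r ≤ ‖θ₀‖ →
        c ≤ probRobustRisk D (ballUniform d ε) 0 (linHyp θ) - nominalRisk D (linHyp θ₀)) := by
  have hunif (d : ℕ) := isProbabilityMeasure_ballUniform (d := d) hε
  have hsupp (d : ℕ) := closedBall_subset_support_ballUniform (d := d) hε.ne'
  refine ⟨fun d D _ θ₀ θ h => ⟨(h.memLp_residual θ).integrable_sq, fun ρ hρ => ?_,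
      h.nominalRisk_linHyp_self, ?_⟩,
    fun ρ hρ => ⟨ε / √(negligibleLevel ρ) *
        (4 * σ ^ 2 + 2 * (1 + ε / √(negligibleLevel ρ)) * R ^ 2),
      fun d hd D _ θ₀ θ h hR hθ => ?_⟩,
    ⟨σ ^ 2 + 2 * ε ^ 2 * R ^ 2, fun d D _ θ₀ θ h hR hθ => ?_⟩,
    fun r hr => ⟨ε ^ 2 / (1 + ε ^ 2) * r ^ 2, by positivity, fun d D _ θ₀ θ h hθ₀ => ?_⟩⟩
  · exact integrable_probRobustLoss_linHyp ae_norm_le_ballUniform hρ.2 (h.memLp_residual θ)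
  · rw [h.nominalRisk_linHyp_self, h.nominalRisk_linHyp]
    exact le_add_of_nonneg_left (sq_nonneg _)
  · rw [h.nominalRisk_linHyp_self]
    exact h.abs_probRobustRisk_ballUniform_sub_sq_le hd hε hρ.1 hρ.2 hR hθ
  · rw [h.nominalRisk_linHyp_self]
    exact h.abs_probRobustRisk_zero_sub_sq_le hε.le ae_norm_le_ballUniform (hsupp d) hR hθ
  · rw [h.nominalRisk_linHyp_self]
    exact le_trans (by gcongr)
      (h.le_probRobustRisk_zero_sub_sq hε.le ae_norm_le_ballUniform (hsupp d) θ)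

theorem mainTheorem3 (σ ε R : ℝ) (hσ : 0 < σ) (hε : 0 < ε) :
    -- all the risks involved are finite, and `θ₀` has the least nominal risk, equal to `σ²`
    (∀ (d : ℕ), 0 < d → ∀ θ₀ θ : Euc d,
      Integrable (fun p => sqLoss (linHyp θ p.1) p.2) (linRegLaw θ₀ σ) ∧
      (∀ ρ ∈ Set.Icc (0 : ℝ) 1,
        Integrable (probRobustLoss (ballUniform d ε) ρ (linHyp θ)) (linRegLaw θ₀ σ)) ∧
      nominalRisk (linRegLaw θ₀ σ) (linHyp θ₀) = σ ^ 2 ∧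
      nominalRisk (linRegLaw θ₀ σ) (linHyp θ₀) ≤ nominalRisk (linRegLaw θ₀ σ) (linHyp θ)) ∧
    -- `ρ > 0`: the gap is `O(1/√d)`
    (∀ ρ ∈ Set.Ioc (0 : ℝ) 1, ∃ C : ℝ, ∀ (d : ℕ), 0 < d →
      ∀ (θ₀ : Euc d) (Θ : Set (Euc d)) (θs : Euc d), ‖θ₀‖ ≤ R → θ₀ ∈ Θ →
        IsProbRobustOptimal θ₀ σ ε ρ Θ θs →
        |probRobustRisk (linRegLaw θ₀ σ) (ballUniform d ε) ρ (linHyp θs) -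
          nominalRisk (linRegLaw θ₀ σ) (linHyp θ₀)| ≤ C / Real.sqrt d) ∧
    -- `ρ = 0`: the gap is bounded
    (∃ C : ℝ, ∀ (d : ℕ), 0 < d →
      ∀ (θ₀ : Euc d) (Θ : Set (Euc d)) (θs : Euc d), ‖θ₀‖ ≤ R → θ₀ ∈ Θ →
        IsProbRobustOptimal θ₀ σ ε 0 Θ θs →
        |probRobustRisk (linRegLaw θ₀ σ) (ballUniform d ε) 0 (linHyp θs) -
          nominalRisk (linRegLaw θ₀ σ) (linHyp θ₀)| ≤ C) ∧
    -- `ρ = 0`: the gap does not vanish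
    (∀ r : ℝ, 0 < r → ∃ c : ℝ, 0 < c ∧ ∀ (d : ℕ), 0 < d →
      ∀ (θ₀ : Euc d) (Θ : Set (Euc d)) (θs : Euc d), r ≤ ‖θ₀‖ → θ₀ ∈ Θ →
        IsProbRobustOptimal θ₀ σ ε 0 Θ θs →
        c ≤ probRobustRisk (linRegLaw θ₀ σ) (ballUniform d ε) 0 (linHyp θs) -
          nominalRisk (linRegLaw θ₀ σ) (linHyp θ₀)) := by
  obtain ⟨hfinite, hpos, hbounded, hgap⟩ := mainTheorem3_general σ ε R hε
  have hmodel {d : ℕ} (θ₀ : Euc d) := isIsotropicLinearModel_linRegLaw θ₀ σ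
  refine ⟨fun d _ θ₀ θ => hfinite d _ θ₀ θ (hmodel θ₀), fun ρ hρ => ?_, ?_, fun r hr => ?_⟩
  · exact (hpos ρ hρ).imp fun C hC d hd θ₀ Θ θs hR hmem hopt =>
      hC d hd _ θ₀ θs (hmodel θ₀) hR (hopt.2 hmem)
  · exact hbounded.imp fun C hC d _ θ₀ Θ θs hR hmem hopt =>
      hC d _ θ₀ θs (hmodel θ₀) hR (hopt.2 hmem)
  · exact (hgap r hr).imp fun c hc => hc.imp_right fun h d _ θ₀ Θ θs hθ₀ _ _ =>
      h d _ θ₀ θs (hmodel θ₀) hθ₀
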